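/- Let $N>2$ and $\zeta=e^{2\pi i/N}$. Let $T(N)$ be the total space of the dual of the Hodge bundle on the (complex) modular curve $X(N)$, with zero section $Z\cong X(N)$. Its points are the isomorphism classes of triples $[C,(x,y),\eta]$, where $C$ is a complex elliptic curve or the $N$-gon, $(x,y)$ is a full level $N$ structure on $C$ with Weil pairing $\zeta$, and $\eta$ is a linear functional on the sections of the dualizing sheaf of $C$. The group $\mathrm{SL}_2(\mathbb Z)$ acts on $T(N)$ through the level structure: $\begin{pmatrix}a&b\\c&d\end{pmatrix}[C,(x,y),\eta]=[C,(ax+by,cx+dy),\eta]$. For $M=\begin{pmatrix}k&l\\m&n\end{pmatrix}\in \mathrm{SL}_2(\mathbb Z)$, $|q|<1$ and $s\in\mathbb C$ let $$(q,s)_M=\psi_M(q,s)=\left[\mathbb C^*/\langle q^N\rangle,\ (q^k\zeta^l,\,q^m\zeta^n),\ s\cdot 2\pi i\,u\,du^*\right]\in T(N),$$ where $u$ is the coordinate of $\mathbb C^*$; for $q=0$ this is understood as the limit triple on the $N$-gon, whose smooth locus is $\mathbb C^*\times\mathbb Z/N$, with level structure $((\zeta^l,k),(\zeta^n,m))$.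 The topology of $T(N)$ is the one in which a set is open if and only if its preimages under all $\psi_M$ are open. Let $\alpha\in Z$ be a cusp corresponding to the point $r\in\mathbb P^1(\mathbb Q)$, that is, $\alpha=(0,0)_{M'}$ for some $M'\in \mathrm{SL}_2(\mathbb Z)$ with $M'\infty=r$. Choose any $M\in\mathrm{SL}_2(\mathbb Z)$ with $M\infty=r$. Then $(q,s)_M$ are local coordinates at $\alpha$: for some $\rho>0$ the map $\psi_M$ is a homeomorphism from $\{(q,s): |q|<1,\ |q|<\rho,\ s\in\mathbb C\}$ onto an open subset of $T(N)$; moreover, for all $|q|<1$ and $s\in\mathbb C$, the point $(q,s)_M$ lies on the fiber of $T(N)\to Z$ over $\alpha$ if and only if $q=0$, it equals $\alpha$ if and only if $(q,s)=(0,0)$, and the fiber over $\alpha$ is $\{(0,s)_M : s\in\mathbb C\}$. If $A\in\mathrm{SL}_2(\mathbb Z)$ fixes at least one point of the fiber over $\alpha$, then there is $k\in\mathbb Z$ such that either $$A(q,s)_M=(\zeta^kq,s)_M\ \text{ for all } |q|<1,\ s\in\mathbb C,\qquad\text{or}\qquad A(q,s)_M=(\zeta^kq,-s)_M\ \text{ for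 all } |q|<1,\ s\in\mathbb C.$$ Consequently $A$ fixes either every point of the fiber over $\alpha$, or no point of that fiber except $\alpha$ itself, which it fixes. -/

import Mathlib

open Complex Topology
open scoped MatrixGroups

noncomputable section

namespace LevelStructures

/-! ### Smooth points: elliptic curves `ℂ / Λ` with full level `N` structure

A smooth elliptic curve over `ℂ` is given as `E = ℂ / Λ`, where `Λ = L.lattice` is the lattice
spanned by a pair of periods `L`.  A point of `E` is given by a representative in `ℂ`.  With `z`
the coordinate of `ℂ`, the space `H⁰(E, ω_E)` is `ℂ dz`, and its dual is `ℂ dz*`. -/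

/-- The covolume of the lattice spanned by `L`. -/
def coarea (L : PeriodPair) : ℝ := |(L.ω₁ * (starRingEnd ℂ) L.ω₂).im|

/-- The Weil pairing of the `N`-torsion points of `ℂ / Λ` represented by `x` and `y`, normalised
so that `⟨τ / N, 1 / N⟩ = exp (2 π i / N)` on `ℂ / (ℤ τ + ℤ)` for `τ` in the upper half plane. -/
def weilPairing (N : ℕ) (L : PeriodPair) (x y : ℂ) : ℂ :=
  exp (2 * Real.pi * I * ((N * ((x * (starRingEnd ℂ) y).im / coarea L) : ℝ) : ℂ))

/-- Triples `[E, (x, y), t dz*]`: an elliptic curve `E = ℂ / Λ`, a full level `N` structure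
`(x, y)` on `E` (two `N`-torsion points with Weil pairing `exp (2 π i / N)`), and the functional
`t dz*` on the holomorphic differentials of `E`. -/
structure SmoothTriple (N : ℕ) where
  L : PeriodPair
  x : ℂ
  y : ℂ
  t : ℂ
  x_torsion : (N : ℂ) * x ∈ L.lattice
  y_torsion : (N : ℂ) * y ∈ L.lattice
  weil : weilPairing N L x y = exp (2 * Real.pi * I / N)

/-- Isomorphism of triples: multiplication by some `c ≠ 0` induces an isomorphism
`ℂ / Λ → ℂ / Λ'`, it has to carry the level structure to the level structure, and the functional
to the functional (`t dz* ↦ c t dz'*`, because `dz'` pulls back to `c dz`). -/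
def SmoothTriple.Iso {N : ℕ} (P Q : SmoothTriple N) : Prop :=
  ∃ c : ℂˣ, (∀ z : ℂ, z ∈ P.L.lattice ↔ (c : ℂ) * z ∈ Q.L.lattice) ∧
    (c : ℂ) * P.x - Q.x ∈ Q.L.lattice ∧ (c : ℂ) * P.y - Q.y ∈ Q.L.lattice ∧ Q.t = c * P.t

theorem SmoothTriple.Iso.refl {N : ℕ} (P : SmoothTriple N) : P.Iso P :=
  ⟨1, by simp, by simp, by simp, by simp⟩

theorem SmoothTriple.Iso.symm {N : ℕ} {P Q : SmoothTriple N} (h : P.Iso Q) : Q.Iso P := by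
  obtain ⟨c, h1, h2, h3, h4⟩ := h
  refine ⟨c⁻¹, fun z => ?_, ?_, ?_, ?_⟩
  · rw [h1]; simp
  · rw [h1, ← neg_mem_iff]; simpa [mul_sub] using h2
  · rw [h1, ← neg_mem_iff]; simpa [mul_sub] using h3
  · rw [h4]; simp

theorem SmoothTriple.Iso.trans {N : ℕ} {P Q R : SmoothTriple N} (h : P.Iso Q) (h' : Q.Iso R) :
    P.Iso R := by
  obtain ⟨c, h1, h2, h3, h4⟩ := h
  obtain ⟨d, k1, k2, k3, k4⟩ := h'
  refine ⟨d * c, fun z => ?_, ?_, ?_, ?_⟩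
  · rw [h1, k1]; simp [mul_assoc]
  · have := add_mem ((k1 _).1 h2) k2
    convert this using 1; push_cast; ring
  · have := add_mem ((k1 _).1 h3) k3
    convert this using 1; push_cast; ring
  · rw [k4, h4]; push_cast; ring

/-! ### Cusp points: the Néron `N`-gon with full level `N` structure

The fibre of the universal curve at a cusp of `X(N)` is the `N`-gon `C`: a cycle of `N` copies of
the projective line.  Its smooth locus is the group `ℂˣ × ℤ/N`.  It is the limit of the Tate
curves `ℂˣ / ⟨q ^ N⟩` as `q → 0`, where `q ^ a * u` tends to `(u, a)`.  The sections of the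
dualizing sheaf of `C` are the multiples of `du / (2 π i u)`, where `u` is the coordinate
of `ℂˣ`, and the dual space is `ℂ · 2 π i u du*`. -/

/-- The smooth locus `ℂˣ × ℤ/N` of the `N`-gon, written multiplicatively. -/
abbrev NGon (N : ℕ) : Type := ℂˣ × Multiplicative (ZMod N)

/-- The index in `{0, …, N - 1}` of the component that contains a point of the `N`-gon. -/
def NGon.comp {N : ℕ} (p : NGon N) : ℕ := (Multiplicative.toAdd p.2).val

/-- The Weil pairing `⟨(u, a), (v, b)⟩ = v ^ a / u ^ b` of `N`-torsion points of the `N`-gon. -/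
def NGon.weilPairing {N : ℕ} (p q : NGon N) : ℂˣ := q.1 ^ p.comp / p.1 ^ q.comp

/-- `ζ = exp (2 π i / N)` as a unit of `ℂ`. -/
def zeta (N : ℕ) : ℂˣ := Units.mk0 (exp (2 * Real.pi * I / N)) (exp_ne_zero _)

/-- Triples `[C, (x, y), t · 2 π i u du*]` with `C` the `N`-gon and `(x, y)` a full level `N`
structure on it: two `N`-torsion points of the smooth locus with Weil pairing
`exp (2 π i / N)`. -/
structure CuspTriple (N : ℕ) where
  x : NGon N
  y : NGon N
  t : ℂ
  x_torsion : x ^ N = 1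
  y_torsion : y ^ N = 1
  weil : NGon.weilPairing x y = zeta N

/-- The automorphisms of the `N`-gon as a generalized elliptic curve: for an `N`-th root of
unity `ξ` and a sign `ε` the map `(u, a) ↦ (ξ ^ a * u, a) ^ ε`. -/
def NGon.aut {N : ℕ} (ξ : ℂˣ) (ε : ℤˣ) (p : NGon N) : NGon N :=
  ((ξ ^ p.comp * p.1, p.2) : NGon N) ^ (ε : ℤ)

/-- Isomorphism of triples on the `N`-gon.  The automorphism given by `(ξ, ε)` pulls `du / u`
back to `ε du / u`, so that it multiplies functionals by `ε`. -/
def CuspTriple.Iso {N : ℕ} (P Q : CuspTriple N) : Prop :=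
  ∃ (ξ : ℂˣ) (ε : ℤˣ), ξ ^ N = 1 ∧ NGon.aut ξ ε P.x = Q.x ∧ NGon.aut ξ ε P.y = Q.y ∧
    Q.t = ((ε : ℤ) : ℂ) * P.t

theorem pow_val_intCast {N : ℕ} [NeZero N] (ξ : ℂˣ) (h : ξ ^ N = 1) (a : ℤ) :
    ξ ^ ((a : ZMod N).val) = ξ ^ a := by
  rw [← zpow_natCast, ZMod.val_intCast]
  conv_rhs => rw [← Int.emod_add_mul_ediv a N, zpow_add, zpow_mul]
  simp [h]

theorem NGon.exists_rep {N : ℕ} (p : NGon N) :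
    ∃ (u : ℂˣ) (a : ℤ), p = (u, Multiplicative.ofAdd (a : ZMod N)) := by
  obtain ⟨u, a⟩ := p
  obtain ⟨b, hb⟩ := ZMod.intCast_surjective (Multiplicative.toAdd a)
  exact ⟨u, b, by rw [hb]; rfl⟩

theorem NGon.aut_rep {N : ℕ} [NeZero N] (ξ : ℂˣ) (h : ξ ^ N = 1) (ε : ℤˣ) (u : ℂˣ) (a : ℤ) :
    NGon.aut ξ ε ((u, Multiplicative.ofAdd (a : ZMod N)) : NGon N) =
      ((ξ ^ a * u) ^ (ε : ℤ), Multiplicative.ofAdd ((((ε : ℤ) * a : ℤ)) : ZMod N)) := by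
  simp only [NGon.aut, NGon.comp, toAdd_ofAdd, pow_val_intCast ξ h]
  ext1
  · rfl
  · change (Multiplicative.ofAdd (a : ZMod N)) ^ (ε : ℤ) = _
    rw [← ofAdd_zsmul]; simp

theorem NGon.aut_one {N : ℕ} [NeZero N] (p : NGon N) : NGon.aut 1 1 p = p := by
  simp [NGon.aut]

theorem NGon.aut_aut {N : ℕ} [NeZero N] (ξ ξ' : ℂˣ) (h : ξ ^ N = 1) (h' : ξ' ^ N = 1)
    (ε ε' : ℤˣ) (p : NGon N) :
    NGon.aut ξ' ε' (NGon.aut ξ ε p) = NGon.aut (ξ' * ξ) (ε' * ε) p := by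
  obtain ⟨u, a, rfl⟩ := p.exists_rep
  rw [NGon.aut_rep ξ h, NGon.aut_rep ξ' h', NGon.aut_rep _ (by rw [mul_pow, h, h', one_mul])]
  ext1
  · rcases Int.units_eq_one_or ε with rfl | rfl <;> rcases Int.units_eq_one_or ε' with rfl | rfl <;>
      simp [mul_zpow, zpow_neg, mul_comm] <;> rw [mul_assoc]
  · push_cast; simp [mul_assoc]

/-- Multiplication rule for automorphisms of the `N`-gon. -/
theorem NGon.aut_mul {N : ℕ} [NeZero N] (ξ : ℂˣ) (h : ξ ^ N = 1) (ε : ℤˣ) (p q : NGon N) :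
    NGon.aut ξ ε (p * q) = NGon.aut ξ ε p * NGon.aut ξ ε q := by
  obtain ⟨u, a, rfl⟩ := p.exists_rep
  obtain ⟨v, b, rfl⟩ := q.exists_rep
  rw [NGon.aut_rep ξ h, NGon.aut_rep ξ h, Prod.mk_mul_mk, ← ofAdd_add, ← Int.cast_add,
    NGon.aut_rep ξ h, Prod.mk_mul_mk, ← ofAdd_add, ← Int.cast_add, mul_add, ← mul_zpow, zpow_add]
  congr 2
  exact mul_mul_mul_comm _ _ _ _

theorem CuspTriple.Iso.refl {N : ℕ} [NeZero N] (P : CuspTriple N) : P.Iso P :=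
  ⟨1, 1, by simp, NGon.aut_one _, NGon.aut_one _, by simp⟩

theorem CuspTriple.Iso.symm {N : ℕ} [NeZero N] {P Q : CuspTriple N} (h : P.Iso Q) : Q.Iso P := by
  obtain ⟨ξ, ε, h1, h2, h3, h4⟩ := h
  have h1' : ξ⁻¹ ^ N = 1 := by simp [h1]
  refine ⟨ξ⁻¹, ε⁻¹, h1', ?_, ?_, ?_⟩
  · rw [← h2, NGon.aut_aut _ _ h1 h1']; simp [NGon.aut_one]
  · rw [← h3, NGon.aut_aut _ _ h1 h1']; simp [NGon.aut_one]
  · rw [h4]; rcases Int.units_eq_one_or ε with rfl | rfl <;> simp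

theorem CuspTriple.Iso.trans {N : ℕ} [NeZero N] {P Q R : CuspTriple N}
    (h : P.Iso Q) (h' : Q.Iso R) : P.Iso R := by
  obtain ⟨ξ, ε, h1, h2, h3, h4⟩ := h
  obtain ⟨ξ', ε', k1, k2, k3, k4⟩ := h'
  refine ⟨ξ' * ξ, ε' * ε, by rw [mul_pow, h1, k1, one_mul], ?_, ?_, ?_⟩
  · rw [← NGon.aut_aut _ _ h1 k1, h2, k2]
  · rw [← NGon.aut_aut _ _ h1 k1, h3, k3]
  · rw [k4, h4]; push_cast; ring

/-! ### The surface `T(N)` -/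

/-- A triple on a smooth elliptic curve, or on the `N`-gon. -/
inductive Triple (N : ℕ) where
  | smooth (P : SmoothTriple N)
  | cusp (P : CuspTriple N)

/-- Isomorphism of triples. -/
def Triple.Iso {N : ℕ} : Triple N → Triple N → Prop
  | .smooth P, .smooth Q => P.Iso Q
  | .cusp P, .cusp Q => P.Iso Q
  | .smooth _, .cusp _ => False
  | .cusp _, .smooth _ => False

instance Triple.setoid (N : ℕ) [NeZero N] : Setoid (Triple N) where
  r := Triple.Iso
  iseqv :=
    { refl := by
        rintro (P | P)
        · exact SmoothTriple.Iso.refl P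
        · exact CuspTriple.Iso.refl P
      symm := by
        rintro (P | P) (Q | Q) h
        · exact SmoothTriple.Iso.symm h
        · exact h
        · exact h
        · exact CuspTriple.Iso.symm h
      trans := by
        rintro (P | P) (Q | Q) (R | R) h k
        · exact SmoothTriple.Iso.trans h k
        · exact k
        · exact h.elim
        · exact h
        · exact h
        · exact h.elim
        · exact k
        · exact CuspTriple.Iso.trans h k }

/-- (The points of) `T(N)`, the total space of the dual of the Hodge bundle on the modular curve
`X(N)`: isomorphism classes of triples `[C, (x, y), η]`, where `C` is a fibre of the universal
curve, `(x, y)` is a full level `N` structure on `C`, and `η` is a linear functional on the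
sections of the dualizing sheaf of `C`. -/
def T (N : ℕ) [NeZero N] : Type := Quotient (Triple.setoid N)

/-- The isomorphism class of a triple. -/
def T.mk {N : ℕ} [NeZero N] (P : Triple N) : T N := Quotient.mk (Triple.setoid N) P

/-! ### The action of `SL(2, ℤ)` -/

/-- `A` sends `[ℂ / Λ, (x, y), t dz*]` to `[ℂ / Λ, (a x + b y, c x + d y), t dz*]`. -/
def SmoothTriple.act {N : ℕ} (A : SL(2, ℤ)) (P : SmoothTriple N) : SmoothTriple N where
  L := P.L
  x := (A 0 0 : ℂ) * P.x + (A 0 1 : ℂ) * P.y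
  y := (A 1 0 : ℂ) * P.x + (A 1 1 : ℂ) * P.y
  t := P.t
  x_torsion := by
    have := add_mem (P.L.lattice.smul_mem (A 0 0) P.x_torsion)
      (P.L.lattice.smul_mem (A 0 1) P.y_torsion)
    simp only [zsmul_eq_mul] at this
    convert this using 1; ring
  y_torsion := by
    have := add_mem (P.L.lattice.smul_mem (A 1 0) P.x_torsion)
      (P.L.lattice.smul_mem (A 1 1) P.y_torsion)
    simp only [zsmul_eq_mul] at this
    convert this using 1; ring
  weil := by
    rw [← P.weil]
    unfold weilPairing
    have h : (A 0 0 * A 1 1 - A 0 1 * A 1 0 : ℝ) = 1 := by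
      have := A.det_coe
      rw [Matrix.det_fin_two] at this
      exact_mod_cast this
    have key : (((A 0 0 : ℂ) * P.x + (A 0 1 : ℂ) * P.y) *
        (starRingEnd ℂ) ((A 1 0 : ℂ) * P.x + (A 1 1 : ℂ) * P.y)).im =
        (P.x * (starRingEnd ℂ) P.y).im := by
      simp only [mul_im, map_add, map_mul, add_re, add_im, mul_re, conj_re, conj_im, intCast_re,
        intCast_im, map_intCast]
      linear_combination (P.x.im * P.y.re - P.x.re * P.y.im) * h
    rw [key]

/-- `A` sends `[C, (x, y), η]` to `[C, (x ^ a * y ^ b, x ^ c * y ^ d), η]` (the smooth locus of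
`C` is written multiplicatively). -/
def CuspTriple.act {N : ℕ} [NeZero N] (A : SL(2, ℤ)) (P : CuspTriple N) : CuspTriple N where
  x := P.x ^ (A 0 0) * P.y ^ (A 0 1)
  y := P.x ^ (A 1 0) * P.y ^ (A 1 1)
  t := P.t
  x_torsion := by
    rw [mul_pow, ← zpow_natCast, ← zpow_natCast, ← zpow_mul', ← zpow_mul', zpow_mul, zpow_mul]
    simp [P.x_torsion, P.y_torsion]
  y_torsion := by
    rw [mul_pow, ← zpow_natCast, ← zpow_natCast, ← zpow_mul', ← zpow_mul', zpow_mul, zpow_mul]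
    simp [P.x_torsion, P.y_torsion]
  weil := by
    rw [← P.weil]
    have hx := P.x_torsion
    have hy := P.y_torsion
    obtain ⟨u, a, hu⟩ := P.x.exists_rep
    obtain ⟨v, b, hv⟩ := P.y.exists_rep
    rw [hu] at hx
    rw [hv] at hy
    have hu1 : u ^ N = 1 := congrArg Prod.fst hx
    have hv1 : v ^ N = 1 := congrArg Prod.fst hy
    have h : A 0 0 * A 1 1 - A 0 1 * A 1 0 = 1 := by
      have := A.det_coe
      rwa [Matrix.det_fin_two] at this
    have hw : ∀ i j : ℤ, (u ^ i * v ^ j) ^ N = 1 := by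
      intro i j
      rw [mul_pow, ← zpow_natCast, ← zpow_natCast, zpow_comm, zpow_comm v]
      simp [hu1, hv1]
    have e : ∀ i j : ℤ, ((u, Multiplicative.ofAdd (a : ZMod N)) : NGon N) ^ i *
        ((v, Multiplicative.ofAdd (b : ZMod N)) : NGon N) ^ j =
        (u ^ i * v ^ j, Multiplicative.ofAdd ((i * a + j * b : ℤ) : ZMod N)) := by
      intro i j
      ext1
      · rfl
      · change Multiplicative.ofAdd (a : ZMod N) ^ i * Multiplicative.ofAdd (b : ZMod N) ^ j = _
        rw [← ofAdd_zsmul, ← ofAdd_zsmul, ← ofAdd_add]; simp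
    rw [hu, hv, e, e]
    simp only [NGon.weilPairing, NGon.comp, toAdd_ofAdd]
    rw [pow_val_intCast _ (hw _ _), pow_val_intCast _ (hw _ _), pow_val_intCast _ hu1,
      pow_val_intCast _ hv1]
    simp only [div_eq_mul_inv, mul_zpow, ← zpow_mul, ← zpow_neg, mul_inv]
    rw [show u ^ (A 1 0 * (A 0 0 * a + A 0 1 * b)) * v ^ (A 1 1 * (A 0 0 * a + A 0 1 * b)) *
        (u ^ (-(A 0 0 * (A 1 0 * a + A 1 1 * b))) * v ^ (-(A 0 1 * (A 1 0 * a + A 1 1 * b)))) =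
        (v ^ (A 1 1 * (A 0 0 * a + A 0 1 * b)) * v ^ (-(A 0 1 * (A 1 0 * a + A 1 1 * b)))) *
        (u ^ (A 1 0 * (A 0 0 * a + A 0 1 * b)) * u ^ (-(A 0 0 * (A 1 0 * a + A 1 1 * b)))) from by
          rw [mul_mul_mul_comm, mul_comm], ← zpow_add, ← zpow_add]
    congr 2
    · linear_combination a * h
    · linear_combination -b * h

/-- The action of `SL(2, ℤ)` on triples. -/
def Triple.act {N : ℕ} [NeZero N] (A : SL(2, ℤ)) : Triple N → Triple N
  | .smooth P => .smooth (P.act A)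
  | .cusp P => .cusp (P.act A)

theorem Triple.act_iso {N : ℕ} [NeZero N] (A : SL(2, ℤ)) {P Q : Triple N} (h : P.Iso Q) :
    (P.act A).Iso (Q.act A) := by
  rcases P with P | P <;> rcases Q with Q | Q
  · obtain ⟨c, h1, h2, h3, h4⟩ := h
    refine ⟨c, h1, ?_, ?_, h4⟩
    · have := add_mem (Q.L.lattice.smul_mem (A 0 0) h2) (Q.L.lattice.smul_mem (A 0 1) h3)
      simp only [zsmul_eq_mul] at this
      change (c : ℂ) * ((A 0 0 : ℂ) * P.x + (A 0 1 : ℂ) * P.y) -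
        ((A 0 0 : ℂ) * Q.x + (A 0 1 : ℂ) * Q.y) ∈ Q.L.lattice
      convert this using 1; ring
    · have := add_mem (Q.L.lattice.smul_mem (A 1 0) h2) (Q.L.lattice.smul_mem (A 1 1) h3)
      simp only [zsmul_eq_mul] at this
      change (c : ℂ) * ((A 1 0 : ℂ) * P.x + (A 1 1 : ℂ) * P.y) -
        ((A 1 0 : ℂ) * Q.x + (A 1 1 : ℂ) * Q.y) ∈ Q.L.lattice
      convert this using 1; ring
  · exact h
  · exact h
  · obtain ⟨ξ, ε, h1, h2, h3, h4⟩ := h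
    have key : ∀ i j : ℤ, NGon.aut ξ ε (P.x ^ i * P.y ^ j) = Q.x ^ i * Q.y ^ j := by
      intro i j
      let f : NGon N →* NGon N := MonoidHom.mk' (NGon.aut ξ ε) (NGon.aut_mul ξ h1 ε)
      have hf : ∀ p, NGon.aut ξ ε p = f p := fun _ => rfl
      rw [hf] at h2 h3 ⊢
      rw [map_mul, map_zpow, map_zpow, h2, h3]
    exact ⟨ξ, ε, h1, key _ _, key _ _, h4⟩

/-- `SL(2, ℤ)` acts on `T(N)`: it permutes the level structures and leaves the curve and the
functional alone. -/
instance (N : ℕ) [NeZero N] : MulAction SL(2, ℤ) (T N) where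
  smul A := Quotient.map (Triple.act A) fun _ _ h => Triple.act_iso A h
  one_smul p := by
    induction p using Quotient.inductionOn with
    | h P =>
      refine congrArg (Quotient.mk _) ?_
      rcases P with P | P <;> simp [Triple.act, SmoothTriple.act, CuspTriple.act]
  mul_smul A B p := by
    induction p using Quotient.inductionOn with
    | h P =>
      refine congrArg (Quotient.mk _) ?_
      rcases P with P | P
      · simp only [Triple.act, SmoothTriple.act, Matrix.SpecialLinearGroup.coe_mul,
          Matrix.mul_apply, Fin.sum_univ_two]
        congr 2 <;> push_cast <;> ring
      · simp only [Triple.act, CuspTriple.act, Matrix.SpecialLinearGroup.coe_mul,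
          Matrix.mul_apply, Fin.sum_univ_two]
        congr 2 <;> simp only [mul_zpow, ← zpow_mul, zpow_add, mul_comm (A _ _)] <;>
          exact mul_mul_mul_comm _ _ _ _

/-! ### The zero section and the fibres -/

/-- Forget the functional: `[C, (x, y), η] ↦ [C, (x, y), 0]`. -/
def Triple.zero {N : ℕ} : Triple N → Triple N
  | .smooth P => .smooth { P with t := 0 }
  | .cusp P => .cusp { P with t := 0 }

/-- The projection `[C, (x, y), η] ↦ [C, (x, y), 0]` of the line bundle `T(N) → X(N)`, where
`X(N)` is identified with the zero section `Z` of `T(N)`. -/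
def proj (N : ℕ) [NeZero N] : T N → T N :=
  Quotient.map Triple.zero <| by
    rintro (P | P) (Q | Q) h
    · obtain ⟨c, h1, h2, h3, -⟩ := h
      exact ⟨c, h1, h2, h3, by simp⟩
    · exact h
    · exact h
    · obtain ⟨ξ, ε, h1, h2, h3, -⟩ := h
      exact ⟨ξ, ε, h1, h2, h3, by simp⟩

/-- The zero section `Z ≅ X(N)`. -/
def zeroSection (N : ℕ) [NeZero N] : Set (T N) := Set.range (proj N)

/-- The fibre of `T(N) → Z` over a point `α` of `Z`. -/
def fiber {N : ℕ} [NeZero N] (α : T N) : Set (T N) := {p | proj N p = α}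

/-! ### The coordinates `(q, s)_M` -/

/-- The periods `N log q / (2 π i)` and `1` of the Tate curve `ℂˣ / ⟨q ^ N⟩`. -/
def tatePeriods (N : ℕ) [NeZero N] (q : ℂ) (hq : q ≠ 0) (hq1 : ‖q‖ < 1) : PeriodPair where
  ω₁ := N * log q / (2 * Real.pi * I)
  ω₂ := 1
  indep := by
    have hN : (N : ℝ) ≠ 0 := Nat.cast_ne_zero.2 (NeZero.ne N)
    have hl : Real.log ‖q‖ ≠ 0 := (Real.log_neg (norm_pos_iff.2 hq) hq1).ne
    rw [LinearIndependent.pair_iff]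
    intro a b h
    have him := congrArg Complex.im h
    have hd : ((N : ℂ) * log q / (2 * Real.pi * I)).im =
        -(N * Real.log ‖q‖ / (2 * Real.pi)) := by
      have : (N : ℂ) * log q / (2 * Real.pi * I) =
          ((N / (2 * Real.pi) : ℝ) : ℂ) * (log q * (-I)) := by
        push_cast
        field_simp
        simp
      rw [this, im_ofReal_mul]
      simp [log_re]
      ring
    have ha : a = 0 := by
      simp only [real_smul, add_im, im_ofReal_mul, hd] at him
      simp only [one_im, zero_im, mul_zero, add_zero, mul_neg, neg_eq_zero] at him
      rcases mul_eq_zero.1 him with h0 | h0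
      · exact h0
      · exact absurd h0 (div_ne_zero (mul_ne_zero hN hl) (by positivity))
    subst ha
    simpa using h

/-- `u = exp (2 π i z)` identifies `ℂ / Λ` with `ℂˣ / ⟨q ^ N⟩`, for the lattice `Λ` spanned by
`tatePeriods N q`. -/
theorem mem_tatePeriods_lattice (N : ℕ) [NeZero N] (q : ℂ) (hq : q ≠ 0) (hq1 : ‖q‖ < 1) (z : ℂ) :
    z ∈ (tatePeriods N q hq hq1).lattice ↔
      ∃ n : ℤ, exp (2 * Real.pi * I * z) = (q ^ N) ^ n := by
  have hpi : (2 * Real.pi * I : ℂ) ≠ 0 := by simp [Real.pi_ne_zero]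
  have hpow : ∀ n : ℤ, (q ^ N) ^ n = exp (n * (N * log q)) := by
    intro n
    rw [exp_int_mul, exp_nat_mul, exp_log hq]
  rw [PeriodPair.mem_lattice]
  simp only [tatePeriods, hpow, exp_eq_exp_iff_exists_int]
  refine exists_congr fun m => exists_congr fun n => ?_
  constructor
  · rintro rfl
    field_simp
  · intro h
    have : z = (2 * Real.pi * I * z) / (2 * Real.pi * I) := by field_simp
    rw [this, h]
    field_simp

/-- The point `[ℂˣ / ⟨q ^ N⟩, (q ^ k ζ ^ l, q ^ m ζ ^ n), s · 2 π i u du*]` for `M = (k l; m n)`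
and `0 < |q| < 1`.  Under `u = exp (2 π i z)` the point `q ^ k ζ ^ l` corresponds to
`z = k log q / (2 π i) + l / N`, and `2 π i u du*` to `dz*`. -/
def tateTriple (N : ℕ) [NeZero N] (M : SL(2, ℤ)) (q s : ℂ) (hq : q ≠ 0) (hq1 : ‖q‖ < 1) :
    SmoothTriple N where
  L := tatePeriods N q hq hq1
  x := (M 0 0 : ℂ) * (log q / (2 * Real.pi * I)) + (M 0 1 : ℂ) / N
  y := (M 1 0 : ℂ) * (log q / (2 * Real.pi * I)) + (M 1 1 : ℂ) / N
  t := s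
  x_torsion := by
    have hN : (N : ℂ) ≠ 0 := Nat.cast_ne_zero.2 (NeZero.ne N)
    refine PeriodPair.mem_lattice.2 ⟨M 0 0, M 0 1, ?_⟩
    simp only [tatePeriods]
    field_simp
  y_torsion := by
    have hN : (N : ℂ) ≠ 0 := Nat.cast_ne_zero.2 (NeZero.ne N)
    refine PeriodPair.mem_lattice.2 ⟨M 1 0, M 1 1, ?_⟩
    simp only [tatePeriods]
    field_simp
  weil := by
    have hN : (N : ℝ) ≠ 0 := Nat.cast_ne_zero.2 (NeZero.ne N)
    set w : ℂ := log q / (2 * Real.pi * I) with hw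
    have hwim : 0 < w.im := by
      have : w = ((1 / (2 * Real.pi) : ℝ) : ℂ) * (log q * (-I)) := by
        rw [hw]; push_cast; field_simp; simp
      rw [this, im_ofReal_mul]
      have hl : Real.log ‖q‖ < 0 := Real.log_neg (norm_pos_iff.2 hq) hq1
      have : 0 < (log q * (-I)).im := by simp [log_re, hl]
      positivity
    have harea : coarea (tatePeriods N q hq hq1) = N * w.im := by
      have : (tatePeriods N q hq hq1).ω₁ = ((N : ℝ) : ℂ) * w := by
        simp [tatePeriods, hw, mul_div_assoc]
      rw [coarea, this]
      simp only [tatePeriods, map_one, mul_one, im_ofReal_mul]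
      exact abs_of_nonneg (by positivity)
    have hdet : (M 0 0 * M 1 1 - M 0 1 * M 1 0 : ℝ) = 1 := by
      have := M.det_coe
      rw [Matrix.det_fin_two] at this
      exact_mod_cast this
    have him : (((M 0 0 : ℂ) * w + (M 0 1 : ℂ) / N) *
        (starRingEnd ℂ) ((M 1 0 : ℂ) * w + (M 1 1 : ℂ) / N)).im = w.im / N := by
      have e0 : ((M 0 1 : ℂ) / N) = ((M 0 1 / N : ℝ) : ℂ) := by push_cast; rfl
      have e1 : ((M 1 1 : ℂ) / N) = ((M 1 1 / N : ℝ) : ℂ) := by push_cast; rfl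
      rw [e0, e1]
      simp only [mul_im, map_add, map_mul, conj_ofReal, add_re, add_im, mul_re, conj_re, conj_im,
        ofReal_re, ofReal_im, intCast_re, intCast_im, map_intCast]
      field_simp
      linear_combination w.im * hdet
    unfold weilPairing
    rw [him, harea]
    congr 1
    have : (N : ℝ) * (w.im / N / (N * w.im)) = 1 / N := by
      field_simp
    rw [this]
    push_cast
    ring

theorem zeta_pow (N : ℕ) [NeZero N] : zeta N ^ N = 1 := by
  ext
  have hN : (N : ℂ) ≠ 0 := Nat.cast_ne_zero.2 (NeZero.ne N)
  simp only [zeta, Units.val_pow_eq_pow_val, Units.val_mk0, Units.val_one, ← exp_nat_mul]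
  rw [mul_div_cancel₀ _ hN, exp_two_pi_mul_I]

/-- The limit of `tateTriple N M q s` as `q → 0`: the `N`-gon with the level structure
`((ζ ^ l, k), (ζ ^ n, m))` for `M = (k l; m n)`, and the functional `s · 2 π i u du*`. -/
def tateTripleZero (N : ℕ) [NeZero N] (M : SL(2, ℤ)) (s : ℂ) : CuspTriple N where
  x := (zeta N ^ (M 0 1), Multiplicative.ofAdd ((M 0 0 : ℤ) : ZMod N))
  y := (zeta N ^ (M 1 1), Multiplicative.ofAdd ((M 1 0 : ℤ) : ZMod N))
  t := s
  x_torsion := by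
    ext1
    · change (zeta N ^ (M 0 1)) ^ N = 1
      rw [← zpow_natCast, zpow_comm, zpow_natCast, zeta_pow, one_zpow]
    · change Multiplicative.ofAdd ((M 0 0 : ℤ) : ZMod N) ^ N = 1
      rw [← ofAdd_nsmul]; simp
  y_torsion := by
    ext1
    · change (zeta N ^ (M 1 1)) ^ N = 1
      rw [← zpow_natCast, zpow_comm, zpow_natCast, zeta_pow, one_zpow]
    · change Multiplicative.ofAdd ((M 1 0 : ℤ) : ZMod N) ^ N = 1
      rw [← ofAdd_nsmul]; simp
  weil := by
    have h : ∀ i : ℤ, (zeta N ^ i) ^ N = 1 := fun i => by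
      rw [← zpow_natCast, zpow_comm, zpow_natCast, zeta_pow, one_zpow]
    have hdet : M 0 0 * M 1 1 - M 0 1 * M 1 0 = 1 := by
      have := M.det_coe
      rwa [Matrix.det_fin_two] at this
    simp only [NGon.weilPairing, NGon.comp, toAdd_ofAdd]
    rw [pow_val_intCast _ (h _), pow_val_intCast _ (h _), ← zpow_mul, ← zpow_mul, div_eq_mul_inv, ← zpow_sub,
      mul_comm (M 1 1), hdet, zpow_one]

/-- The open unit disk, in which the coordinate `q` varies. -/
abbrev Disk : Type := Metric.ball (0 : ℂ) 1

/-- The map `ψ_M : (q, s) ↦ (q, s)_M`. -/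
def psi (N : ℕ) [NeZero N] (M : SL(2, ℤ)) (p : Disk × ℂ) : T N :=
  if hq : (p.1 : ℂ) = 0 then
    T.mk (.cusp (tateTripleZero N M p.2))
  else
    T.mk (.smooth (tateTriple N M p.1 p.2 hq (mem_ball_zero_iff.1 p.1.2)))

/-- The topology of `T(N)`: a set is open if and only if its preimage under every `ψ_M` is open.
(The images of the maps `ψ_M` cover `T(N)`: with `q = exp (2 π i τ / N)`, the map `ψ_1` alone
parametrises the points `[ℂ / (ℤ τ + ℤ), (τ / N, 1 / N), s dz*]`.) -/
instance (N : ℕ) [NeZero N] : TopologicalSpace (T N) :=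
  ⨆ M : SL(2, ℤ), TopologicalSpace.coinduced (psi N M) inferInstance

/-- The point of the zero section `α` is the cusp corresponding to `r ∈ ℙ¹(ℚ)`: it is the limit
`(0, 0)_M` of the points `(q, 0)_M = [E_{Mτ}, (Mτ / N, 1 / N), 0]`, `q = exp (2 π i τ / N)`, as
`τ → i ∞`, for some `M` such that `M ∞ = r`. -/
def IsCuspAt {N : ℕ} [NeZero N] (α : T N) (r : OnePoint ℚ) : Prop :=
  ∃ M : SL(2, ℤ), Matrix.SpecialLinearGroup.mapGL ℚ M • (OnePoint.infty : OnePoint ℚ) = r ∧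
    ∃ q : Disk, (q : ℂ) = 0 ∧ α = psi N M (q, 0)

/-- The rotation `q ↦ ζ ^ k q` of the disk. -/
def rot (N : ℕ) (k : ℤ) (q : Disk) : Disk :=
  ⟨exp (2 * Real.pi * I / N) ^ k * q, by
    have h : ‖exp (2 * Real.pi * I / N)‖ = 1 := by
      have : (2 * Real.pi * I / N : ℂ) = ((2 * Real.pi / N : ℝ) : ℂ) * I := by push_cast; ring
      rw [this, norm_exp_ofReal_mul_I]
    rw [mem_ball_zero_iff, norm_mul, norm_zpow, h, one_zpow, one_mul]
    exact mem_ball_zero_iff.1 q.2⟩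

end LevelStructures

end

noncomputable section

namespace LevelStructures

/-! Everything rests on deciding when two points `(q', s')_{M'}` and `(q, s)_M` coincide. Write `q =
exp (2πiσ)` and `q' = exp (2πiσ')`. Away from the cusps, an isomorphism of Tate curves is a matrix
`g ∈ SL(2, ℤ)` with `N σ' = g (N σ)`. It respects the level structures iff `M' g ≡ M` mod `N`, and
it scales functionals by the automorphy factor (`psi_eq_psi_iff`). On the `N`-gon the same rule
holds with `g` restricted to `± (1 i; 0 1)`, because these matrices describe the automorphisms of
the `N`-gon (`psi_eq_psi_iff_of_eq_zero`).

Such identifications extend continuously to neighbouring points, so every `ψ_M` is open. For `q` and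
`q'` small, `g` maps a point with `Im > 1` to another such point, hence fixes `∞`. If also `g ≡ 1`
mod `N`, then `N > 2` excludes the sign `-1` and the translation is by a multiple of `N`, so `q' =
q` and `s' = s`. This gives the local coordinates.

Finally `A (q, s)_M = (q, s)_{AM}`. A fixed point over the cusp yields `A M g ≡ M` mod `N` for some
`g = ± (1 i; 0 1)`, and this one congruence determines the action at all `(q, s)`: `g` rotates `q`
by `ζ ^ (-i)` and multiplies `s` by the sign (`psi_eq_psi_rot`). -/

/-! ### Reduction modulo `N` and the stabilizer of `∞` -/

/-- Reduction modulo `N`. -/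
def red (N : ℕ) : SL(2, ℤ) →* SL(2, ZMod N) :=
  Matrix.SpecialLinearGroup.map (Int.castRingHom (ZMod N))

theorem red_eq_iff_dvd {N : ℕ} {A B : SL(2, ℤ)} :
    red N A = red N B ↔ ∀ i j, (N : ℤ) ∣ A i j - B i j := by
  rw [Matrix.SpecialLinearGroup.ext_iff]
  refine forall_congr' fun i => forall_congr' fun j => ?_
  rw [← ZMod.intCast_eq_intCast_iff_dvd_sub, eq_comm]
  rfl

/-- The element `± (1 i; 0 1)` of the stabilizer of `∞`. -/
def parabolic (ε : ℤˣ) (i : ℤ) : SL(2, ℤ) :=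
  ⟨!![(ε : ℤ), ε * i; 0, ε], by simp [Matrix.det_fin_two, ← Units.val_mul, Int.units_mul_self]⟩

@[simp] theorem parabolic_zero_zero (ε : ℤˣ) (i : ℤ) : parabolic ε i 0 0 = ε := rfl
@[simp] theorem parabolic_zero_one (ε : ℤˣ) (i : ℤ) : parabolic ε i 0 1 = ε * i := rfl
@[simp] theorem parabolic_one_zero (ε : ℤˣ) (i : ℤ) : parabolic ε i 1 0 = 0 := rfl
@[simp] theorem parabolic_one_one (ε : ℤˣ) (i : ℤ) : parabolic ε i 1 1 = ε := rfl

theorem exists_eq_parabolic {g : SL(2, ℤ)} (hg : g 1 0 = 0) : ∃ ε i, g = parabolic ε i := by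
  have hdet := g.det_coe
  rw [Matrix.det_fin_two, hg, mul_zero, sub_zero] at hdet
  rcases Int.mul_eq_one_iff_eq_one_or_neg_one.1 hdet with ⟨h0, h1⟩ | ⟨h0, h1⟩
  · refine ⟨1, g 0 1, ?_⟩
    ext i j
    fin_cases i <;> fin_cases j <;> simp [h0, h1, hg]
  · refine ⟨-1, -g 0 1, ?_⟩
    ext i j
    fin_cases i <;> fin_cases j <;> simp [h0, h1, hg]

/-- `M'⁻¹ M` fixes `∞`, so its lower left entry vanishes. This measures the freedom in choosing `M`
for a given cusp. -/
theorem exists_eq_mul_parabolic {M M' : SL(2, ℤ)}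
    (h : Matrix.SpecialLinearGroup.mapGL ℚ M • (OnePoint.infty : OnePoint ℚ) =
      Matrix.SpecialLinearGroup.mapGL ℚ M' • (OnePoint.infty : OnePoint ℚ)) :
    ∃ ε i, M = M' * parabolic ε i := by
  rw [← inv_smul_eq_iff, ← map_inv, smul_smul, ← map_mul, OnePoint.smul_infty_eq_self_iff] at h
  have h' : (M'⁻¹ * M) 1 0 = 0 := by
    have : (((M'⁻¹ * M) 1 0 : ℤ) : ℚ) = 0 := h
    exact_mod_cast this
  obtain ⟨ε, i, h⟩ := exists_eq_parabolic h'
  exact ⟨ε, i, by rw [← h, mul_inv_cancel_left]⟩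

theorem eq_one_and_dvd_of_red_parabolic {N : ℕ} (hN : 2 < N) {ε : ℤˣ} {i : ℤ}
    (h : red N (parabolic ε i) = 1) : ε = 1 ∧ (N : ℤ) ∣ i := by
  rw [← map_one (red N), red_eq_iff_dvd] at h
  have h0 := h 0 0
  have h1 := h 0 1
  rcases Int.units_eq_one_or ε with rfl | rfl
  · exact ⟨rfl, by simpa using h1⟩
  -- For `ε = -1` the upper left entry gives `N ∣ -2`, which `N > 2` forbids.
  · have := Int.le_of_dvd (by norm_num) ((dvd_neg (a := (N : ℤ)) (b := 2)).1 (by simpa using h0))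
    omega

/-! ### The action on the points `(q, s)_M` -/

theorem psi_of_ne {N : ℕ} [NeZero N] (M : SL(2, ℤ)) {p : Disk × ℂ} (hq : (p.1 : ℂ) ≠ 0) :
    psi N M p = T.mk (.smooth (tateTriple N M p.1 p.2 hq (mem_ball_zero_iff.1 p.1.2))) :=
  dif_neg hq

theorem psi_of_eq {N : ℕ} [NeZero N] (M : SL(2, ℤ)) {p : Disk × ℂ} (hq : (p.1 : ℂ) = 0) :
    psi N M p = T.mk (.cusp (tateTripleZero N M p.2)) :=
  dif_pos hq

theorem smul_mk {N : ℕ} [NeZero N] (A : SL(2, ℤ)) (P : Triple N) :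
    A • T.mk P = T.mk (P.act A) := rfl

theorem mk_eq_mk {N : ℕ} [NeZero N] {P Q : Triple N} : T.mk P = T.mk Q ↔ P.Iso Q :=
  Quotient.eq (r := Triple.setoid N)

/-- The two points of the level structure are linear in the rows of `M`, so acting on them is left
multiplication. -/
theorem smul_psi {N : ℕ} [NeZero N] (A M : SL(2, ℤ)) (p : Disk × ℂ) :
    A • psi N M p = psi N (A * M) p := by
  by_cases hq : (p.1 : ℂ) = 0
  · rw [psi_of_eq M hq, psi_of_eq _ hq, smul_mk]
    congr 1
    simp only [Triple.act, CuspTriple.act, tateTripleZero]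
    have key : ∀ a b i j k l : ℤ, ((zeta N ^ k, Multiplicative.ofAdd (i : ZMod N)) : NGon N) ^ a *
        ((zeta N ^ l, Multiplicative.ofAdd (j : ZMod N)) : NGon N) ^ b =
        (zeta N ^ (a * k + b * l), Multiplicative.ofAdd ((a * i + b * j : ℤ) : ZMod N)) := by
      intro a b i j k l
      ext1
      · change (zeta N ^ k) ^ a * (zeta N ^ l) ^ b = _
        rw [← zpow_mul', ← zpow_mul', ← zpow_add]
      · change Multiplicative.ofAdd (i : ZMod N) ^ a * Multiplicative.ofAdd (j : ZMod N) ^ b = _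
        rw [← ofAdd_zsmul, ← ofAdd_zsmul, ← ofAdd_add]; simp
    congr 2 <;> rw [key] <;> simp [Matrix.mul_apply, Fin.sum_univ_two]
  · rw [psi_of_ne M hq, psi_of_ne _ hq, smul_mk]
    congr 1
    simp only [Triple.act, SmoothTriple.act, tateTriple]
    congr 2 <;> simp [Matrix.mul_apply, Fin.sum_univ_two] <;> ring

/-! ### Isomorphisms between Tate curves -/

theorem im_pos_of_exp_eq {q σ : ℂ} (hq1 : ‖q‖ < 1) (hσ : exp (2 * Real.pi * I * σ) = q) :
    0 < σ.im := by
  rw [← hσ, norm_exp, Real.exp_lt_one_iff] at hq1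
  have : (2 * Real.pi * I * σ).re = -(2 * Real.pi * σ.im) := by simp
  rw [this, neg_lt_zero] at hq1
  exact (mul_pos_iff_of_pos_left (by positivity)).1 hq1

/-- Any logarithm `2πiσ` of `q` may replace the principal one. This freedom allows a branch to be
chosen near each point, and `σ` to be shifted by `i / N`. -/
theorem mem_tatePeriods_lattice_iff_of_exp_eq {N : ℕ} [NeZero N] {q σ : ℂ} (hq : q ≠ 0)
    (hq1 : ‖q‖ < 1) (hσ : exp (2 * Real.pi * I * σ) = q) (z : ℂ) :
    z ∈ (tatePeriods N q hq hq1).lattice ↔ ∃ m n : ℤ, m * (N * σ) + n = z := by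
  rw [mem_tatePeriods_lattice]
  have hpow : ∀ n : ℤ, (q ^ N) ^ n = exp (n * (N * (2 * Real.pi * I * σ))) := by
    intro n
    rw [exp_int_mul, exp_nat_mul, hσ]
  simp only [hpow, exp_eq_exp_iff_exists_int]
  refine exists_congr fun m => exists_congr fun n => ?_
  rw [show (m * (N * (2 * Real.pi * I * σ)) + n * (2 * Real.pi * I) : ℂ) =
    2 * Real.pi * I * (m * (N * σ) + n) by ring, mul_right_inj' two_pi_I_ne_zero, eq_comm]

theorem exists_log_div_eq {q σ : ℂ} (hq : q ≠ 0) (hσ : exp (2 * Real.pi * I * σ) = q) :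
    ∃ j : ℤ, log q / (2 * Real.pi * I) = σ + j := by
  obtain ⟨j, hj⟩ := exp_eq_exp_iff_exists_int.1 ((exp_log hq).trans hσ.symm)
  refine ⟨j, ?_⟩
  rw [hj, div_eq_iff two_pi_I_ne_zero]
  ring

/-- `σ` and `1 / N` form a `ℤ/N`-basis of the `N`-torsion. The imaginary part isolates the
coefficient of `σ`. -/
theorem torsion_mem_tatePeriods_lattice_iff {N : ℕ} [NeZero N] {q σ : ℂ} (hq : q ≠ 0)
    (hq1 : ‖q‖ < 1) (hσ : exp (2 * Real.pi * I * σ) = q) (u v : ℤ) :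
    u * σ + v / N ∈ (tatePeriods N q hq hq1).lattice ↔ (N : ℤ) ∣ u ∧ (N : ℤ) ∣ v := by
  have hN : (N : ℂ) ≠ 0 := Nat.cast_ne_zero.2 (NeZero.ne N)
  rw [mem_tatePeriods_lattice_iff_of_exp_eq hq hq1 hσ]
  constructor
  · rintro ⟨m, n, h⟩
    have him : (N * m : ℝ) = u := by
      have := congrArg Complex.im h
      have h0 : ((v : ℂ) / N).im = 0 := by
        rw [show ((v : ℂ) / N) = ((v / N : ℝ) : ℂ) by push_cast; rfl, ofReal_im]
      have hp := im_pos_of_exp_eq hq1 hσ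
      simp [h0] at this
      have h' : (N * m - u) * σ.im = 0 := by linear_combination this
      rcases mul_eq_zero.1 h' with h' | h'
      · linarith
      · exact absurd h' hp.ne'
    have hu : u = N * m := by exact_mod_cast him.symm
    refine ⟨⟨m, hu⟩, n, ?_⟩
    rw [hu] at h
    have : (v : ℂ) = N * n := by
      push_cast at h
      field_simp at h
      linear_combination -h
    exact_mod_cast this
  · rintro ⟨⟨m, rfl⟩, n, rfl⟩
    refine ⟨m, n, ?_⟩
    push_cast
    field_simp

/-- This is the oriented area of the parallelogram on two lattice vectors. It detects the sign of a
base change and the nonvanishing of an automorphy factor. -/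
theorem im_mul_conj_of_int (a b c d : ℤ) (z : ℂ) :
    ((a * z + b) * (starRingEnd ℂ) (c * z + d)).im = (a * d - b * c) * z.im := by
  simp
  ring

/-- The Tate triples at `q = exp (2 π i σ)` and `q' = exp (2 π i σ')` are isomorphic if and only
if `N σ' = g (N σ)` for a `g ∈ SL(2, ℤ)` that carries the level structures to each other. -/
theorem psi_eq_psi_iff {N : ℕ} [NeZero N] (M M' : SL(2, ℤ)) {p p' : Disk × ℂ} {σ σ' : ℂ}
    (hσ : exp (2 * Real.pi * I * σ) = p.1) (hσ' : exp (2 * Real.pi * I * σ') = p'.1) :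
    psi N M' p' = psi N M p ↔ ∃ g : SL(2, ℤ), red N (M' * g) = red N M ∧
      (g 1 0 * (N * σ) + g 1 1) * (N * σ') = g 0 0 * (N * σ) + g 0 1 ∧
      p.2 = (g 1 0 * (N * σ) + g 1 1) * p'.2 := by
  have hN : (N : ℂ) ≠ 0 := Nat.cast_ne_zero.2 (NeZero.ne N)
  have hq : (p.1 : ℂ) ≠ 0 := hσ ▸ exp_ne_zero _
  have hq' : (p'.1 : ℂ) ≠ 0 := hσ' ▸ exp_ne_zero _
  have hq1 : ‖(p.1 : ℂ)‖ < 1 := mem_ball_zero_iff.1 p.1.2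
  have hq1' : ‖(p'.1 : ℂ)‖ < 1 := mem_ball_zero_iff.1 p'.1.2
  have him : 0 < ((N : ℂ) * σ).im := by
    simpa [NeZero.pos N] using im_pos_of_exp_eq hq1 hσ
  have him' : 0 < ((N : ℂ) * σ').im := by
    simpa [NeZero.pos N] using im_pos_of_exp_eq hq1' hσ'
  have hΛ := mem_tatePeriods_lattice_iff_of_exp_eq (N := N) hq hq1 hσ
  have hΛ' := mem_tatePeriods_lattice_iff_of_exp_eq (N := N) hq' hq1' hσ'
  obtain ⟨j, hj⟩ := exists_log_div_eq hq hσ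
  obtain ⟨j', hj'⟩ := exists_log_div_eq hq' hσ'
  rw [psi_of_ne M hq, psi_of_ne M' hq', mk_eq_mk]
  -- the condition on a component of the level structure
  have level : ∀ (c : ℂ) (g : SL(2, ℤ)), c = g 1 0 * (N * σ) + g 1 1 →
      c * (N * σ') = g 0 0 * (N * σ) + g 0 1 → ∀ k l k' l' : ℤ,
      (c * (k' * (log p'.1 / (2 * Real.pi * I)) + l' / N) -
        (k * (log p.1 / (2 * Real.pi * I)) + l / N) ∈ (tatePeriods N p.1 hq hq1).lattice ↔
      (N : ℤ) ∣ (k' * g 0 0 + l' * g 1 0) - k ∧ (N : ℤ) ∣ (k' * g 0 1 + l' * g 1 1) - l) := by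
    intro c g hc1 hc2 k l k' l'
    rw [← torsion_mem_tatePeriods_lattice_iff hq hq1 hσ]
    -- Passing from the principal logarithms to `σ` and `σ'` shifts the expression by this vector,
    -- which lies in the lattice because `c` and `1` do.
    have hmem : c * (k' * j') - k * j ∈ (tatePeriods N p.1 hq hq1).lattice := by
      rw [hΛ]
      refine ⟨k' * j' * g 1 0, k' * j' * g 1 1 - k * j, ?_⟩
      rw [hc1]; push_cast; ring
    rw [← add_mem_cancel_right hmem (y := _ + _), hj, hj']
    refine iff_of_eq (congrArg (· ∈ _) ?_)
    push_cast
    field_simp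
    linear_combination (k' : ℂ) * hc2 + (l' : ℂ) * hc1
  have levels : ∀ (c : ℂ) (g : SL(2, ℤ)), c = g 1 0 * (N * σ) + g 1 1 →
      c * (N * σ') = g 0 0 * (N * σ) + g 0 1 →
      ((c * (tateTriple N M' p'.1 p'.2 hq' hq1').x - (tateTriple N M p.1 p.2 hq hq1).x ∈
        (tatePeriods N p.1 hq hq1).lattice ∧
      c * (tateTriple N M' p'.1 p'.2 hq' hq1').y - (tateTriple N M p.1 p.2 hq hq1).y ∈
        (tatePeriods N p.1 hq hq1).lattice) ↔ red N (M' * g) = red N M) := by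
    intro c g hc1 hc2
    rw [red_eq_iff_dvd]
    simp only [tateTriple, Fin.forall_fin_two, Matrix.SpecialLinearGroup.coe_mul, Matrix.mul_apply,
      Fin.sum_univ_two]
    rw [level c g hc1 hc2, level c g hc1 hc2]
  constructor
  · rintro ⟨c, hc, hx, hy, ht⟩
    -- Multiplication by `c` and by `c⁻¹` on the bases `(N σ', 1)` and `(N σ, 1)` gives two integer
    -- matrices.
    obtain ⟨a, b, hab⟩ := (hΛ _).1 ((hc _).1 ((hΛ' (N * σ')).2 ⟨1, 0, by simp⟩))
    obtain ⟨e, d, hed⟩ := (hΛ _).1 ((hc _).1 ((hΛ' 1).2 ⟨0, 1, by simp⟩))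
    obtain ⟨a', b', hab'⟩ := (hΛ' (c⁻¹ * (N * σ))).1 ((hc _).2 ((hΛ _).2 ⟨1, 0, by simp⟩))
    obtain ⟨e', d', hed'⟩ := (hΛ' c⁻¹).1 ((hc _).2 ((hΛ _).2 ⟨0, 1, by simp⟩))
    rw [mul_one] at hed
    have hn : 0 < normSq (c : ℂ) := normSq_pos.2 c.ne_zero
    -- Comparing oriented areas, both determinants are positive with product `1`, so both equal `1`.
    have h1 : (a * d - b * e) * ((N : ℂ) * σ).im = normSq (c : ℂ) * ((N : ℂ) * σ').im := by
      rw [← im_mul_conj_of_int, hab, hed, mul_right_comm, mul_conj, im_ofReal_mul]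
    have h2 : normSq (c : ℂ) * ((a' * d' - b' * e') * ((N : ℂ) * σ').im) = ((N : ℂ) * σ).im := by
      rw [← im_mul_conj_of_int, hab', hed', Units.val_inv_eq_inv_val, mul_right_comm, mul_conj,
        im_ofReal_mul, normSq_inv, mul_inv_cancel_left₀ hn.ne']
    have hpos : (0 : ℝ) < a * d - b * e :=
      pos_of_mul_pos_left (h1 ▸ mul_pos hn him') him.le
    have hprod : ((a * d - b * e) * (a' * d' - b' * e') : ℝ) = 1 := by
      refine mul_right_cancel₀ him.ne' ?_
      linear_combination (a' * d' - b' * e' : ℝ) * h1 + h2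
    have hdet : a * d - b * e = 1 := by
      have hp : 0 < a * d - b * e := by exact_mod_cast hpos
      have hpr : (a * d - b * e) * (a' * d' - b' * e') = 1 := by exact_mod_cast hprod
      rcases Int.mul_eq_one_iff_eq_one_or_neg_one.1 hpr with h | h <;> omega
    let g : SL(2, ℤ) := ⟨!![a, b; e, d], by rw [Matrix.det_fin_two]; exact hdet⟩
    have hc1 : (c : ℂ) = g 1 0 * (N * σ) + g 1 1 := hed.symm
    have hc2 : (c : ℂ) * (N * σ') = g 0 0 * (N * σ) + g 0 1 := hab.symm
    exact ⟨g, (levels c g hc1 hc2).1 ⟨hx, hy⟩, by rw [← hc1, hc2], by rw [← hc1]; exact ht⟩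
  · rintro ⟨g, hg, h, hs⟩
    have hdet : g 0 0 * g 1 1 - g 0 1 * g 1 0 = 1 := by
      have := g.det_coe
      rwa [Matrix.det_fin_two] at this
    have hdetC : (g 0 0 * g 1 1 - g 0 1 * g 1 0 : ℂ) = 1 := by exact_mod_cast hdet
    have hc0 : (g 1 0 * (N * σ) + g 1 1 : ℂ) ≠ 0 := by
      intro h0
      have := im_mul_conj_of_int (g 0 0) (g 0 1) (g 1 0) (g 1 1) (N * σ)
      rw [h0, map_zero, mul_zero, zero_im] at this
      have hd : (g 0 0 * g 1 1 - g 0 1 * g 1 0 : ℝ) = 1 := by exact_mod_cast hdet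
      rw [hd, one_mul] at this
      exact him.ne this
    have hxy := (levels _ g rfl h).2 hg
    refine ⟨Units.mk0 _ hc0, fun z => ?_, hxy.1, hxy.2, hs⟩
    change z ∈ (tatePeriods N p'.1 hq' hq1').lattice ↔ _ ∈ (tatePeriods N p.1 hq hq1).lattice
    rw [hΛ, hΛ', Units.val_mk0]
    constructor
    · rintro ⟨m, n, rfl⟩
      refine ⟨m * g 0 0 + n * g 1 0, m * g 0 1 + n * g 1 1, ?_⟩
      push_cast
      linear_combination -(m : ℂ) * h
    · rintro ⟨m, n, hmn⟩
      -- These coefficients are the row vector `(m, n) g⁻¹`.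
      refine ⟨m * g 1 1 - n * g 1 0, n * g 0 0 - m * g 0 1, mul_left_cancel₀ hc0 ?_⟩
      rw [← hmn]
      push_cast
      linear_combination (m * g 1 1 - n * g 1 0 : ℂ) * h + (m * (N * σ) + n : ℂ) * hdetC

/-! ### Isomorphisms between cusp triples -/

theorem isPrimitiveRoot_zeta (N : ℕ) [NeZero N] : IsPrimitiveRoot (zeta N) N :=
  IsPrimitiveRoot.coe_units_iff.1 (isPrimitiveRoot_exp N (NeZero.ne N))

theorem zeta_zpow_eq_iff_dvd {N : ℕ} [NeZero N] {a b : ℤ} :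
    zeta N ^ a = zeta N ^ b ↔ (N : ℤ) ∣ a - b := by
  rw [← (isPrimitiveRoot_zeta N).zpow_eq_one_iff_dvd, zpow_sub, mul_inv_eq_one]

/-- If the point `(ζ ^ l', k')` is recorded as the row `(k', l')`, then the automorphism `(ζ ^ i,
ε)` is right multiplication by `parabolic ε i`. The divisibilities compare entries modulo `N`. -/
theorem aut_zeta_zpow_eq_iff {N : ℕ} [NeZero N] (i : ℤ) (ε : ℤˣ) (k l k' l' : ℤ) :
    NGon.aut (zeta N ^ i) ε (zeta N ^ l', Multiplicative.ofAdd (k' : ZMod N)) =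
      (zeta N ^ l, Multiplicative.ofAdd (k : ZMod N)) ↔
      (N : ℤ) ∣ k' * ε - k ∧ (N : ℤ) ∣ (k' * (ε * i) + l' * ε) - l := by
  have h : (zeta N ^ i) ^ N = 1 := by
    rw [← zpow_natCast, zpow_comm, zpow_natCast, zeta_pow, one_zpow]
  rw [NGon.aut_rep _ h, Prod.mk.injEq, ← zpow_mul, ← zpow_add, ← zpow_mul, zeta_zpow_eq_iff_dvd,
    Multiplicative.ofAdd.injective.eq_iff, eq_comm (a := ((_ : ℤ) : ZMod N)),
    ZMod.intCast_eq_intCast_iff_dvd_sub, and_comm]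
  ring_nf

/-- Every `N`-th root of unity is a power of `ζ`, so each automorphism of the `N`-gon comes from
some `parabolic ε i`. This is the degenerate case of `psi_eq_psi_iff`. -/
theorem psi_eq_psi_iff_of_eq_zero {N : ℕ} [NeZero N] (M M' : SL(2, ℤ)) {p p' : Disk × ℂ}
    (hp : (p.1 : ℂ) = 0) (hp' : (p'.1 : ℂ) = 0) :
    psi N M' p' = psi N M p ↔ ∃ (ε : ℤˣ) (i : ℤ), red N (M' * parabolic ε i) = red N M ∧
      p.2 = ((ε : ℤ) : ℂ) * p'.2 := by
  rw [psi_of_eq M hp, psi_of_eq M' hp', mk_eq_mk]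
  have key : ∀ (ε : ℤˣ) (i : ℤ), red N (M' * parabolic ε i) = red N M ↔
      NGon.aut (zeta N ^ i) ε (tateTripleZero N M' p'.2).x = (tateTripleZero N M p.2).x ∧
      NGon.aut (zeta N ^ i) ε (tateTripleZero N M' p'.2).y = (tateTripleZero N M p.2).y := by
    intro ε i
    simp only [tateTripleZero, aut_zeta_zpow_eq_iff, red_eq_iff_dvd, Fin.forall_fin_two,
      Matrix.SpecialLinearGroup.coe_mul, Matrix.mul_apply, Fin.sum_univ_two, parabolic_zero_zero,
      parabolic_zero_one, parabolic_one_zero, parabolic_one_one, mul_zero, add_zero]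
  constructor
  · rintro ⟨ξ, ε, hξ, hx, hy, ht⟩
    obtain ⟨i, -, hi⟩ := (isPrimitiveRoot_exp N (NeZero.ne N)).eq_pow_of_pow_eq_one
      (ξ := (ξ : ℂ)) (by rw [← Units.val_pow_eq_pow_val, hξ, Units.val_one])
    obtain rfl : zeta N ^ i = ξ := Units.ext (by simpa [zeta] using hi)
    rw [← zpow_natCast] at hx hy
    exact ⟨ε, i, (key ε i).2 ⟨hx, hy⟩, ht⟩
  · rintro ⟨ε, i, h, ht⟩
    have := (key ε i).1 h
    refine ⟨zeta N ^ i, ε, ?_, this.1, this.2, ht⟩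
    rw [← zpow_natCast, zpow_comm, zpow_natCast, zeta_pow, one_zpow]

theorem eq_zero_iff_of_psi_eq {N : ℕ} [NeZero N] {M M' : SL(2, ℤ)} {p p' : Disk × ℂ}
    (h : psi N M' p' = psi N M p) : (p'.1 : ℂ) = 0 ↔ (p.1 : ℂ) = 0 := by
  by_cases hp : (p.1 : ℂ) = 0 <;> by_cases hp' : (p'.1 : ℂ) = 0
  · simp [hp, hp']
  · rw [psi_of_eq M hp, psi_of_ne M' hp', mk_eq_mk] at h
    exact h.elim
  · rw [psi_of_ne M hp, psi_of_eq M' hp', mk_eq_mk] at h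
    exact h.elim
  · simp [hp, hp']

/-! ### Rotations of the coordinate `q`. -/

theorem exp_two_pi_I_mul_log_div {q : ℂ} (hq : q ≠ 0) :
    exp (2 * Real.pi * I * (log q / (2 * Real.pi * I))) = q := by
  rw [mul_div_cancel₀ _ two_pi_I_ne_zero, exp_log hq]

theorem coe_rot {N : ℕ} (k : ℤ) (q : Disk) :
    (rot N k q : ℂ) = exp (2 * Real.pi * I / N) ^ k * q := rfl

theorem rot_eq_self {N : ℕ} (k : ℤ) {q : Disk} (hq : (q : ℂ) = 0) : rot N k q = q :=
  Subtype.ext (by rw [coe_rot, hq, mul_zero])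

theorem continuous_rot (N : ℕ) (k : ℤ) : Continuous (rot N k) :=
  Continuous.subtype_mk (continuous_const.mul continuous_subtype_val) _

/-- Right translation of `M` by the stabilizer of `∞` rotates the coordinate `q`. -/
theorem psi_eq_psi_rot {N : ℕ} [NeZero N] {M M' : SL(2, ℤ)} {ε : ℤˣ} {i : ℤ}
    (h : red N (M' * parabolic ε i) = red N M) (p : Disk × ℂ) :
    psi N M' p = psi N M (rot N (-i) p.1, ((ε : ℤ) : ℂ) * p.2) := by
  have hN : (N : ℂ) ≠ 0 := Nat.cast_ne_zero.2 (NeZero.ne N)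
  by_cases hq : (p.1 : ℂ) = 0
  · exact (psi_eq_psi_iff_of_eq_zero M M' (by simp only [coe_rot, hq, mul_zero]) hq).2
      ⟨ε, i, h, rfl⟩
  · have hσ' := exp_two_pi_I_mul_log_div hq
    -- The shift is forced by `N σ' = N σ + i`, and it multiplies `q` by `ζ ^ (-i)`.
    refine (psi_eq_psi_iff M M' (σ := log p.1 / (2 * Real.pi * I) - i / N) ?_ hσ').2
      ⟨parabolic ε i, h, ?_, ?_⟩
    · rw [mul_sub, sub_eq_add_neg, exp_add, hσ', coe_rot, mul_comm, ← exp_int_mul]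
      congr 2
      push_cast
      ring
    · simp only [parabolic_zero_zero, parabolic_zero_one, parabolic_one_zero, parabolic_one_one]
      push_cast
      field_simp
      ring
    · simp

/-! ### The topology near a point -/

theorem continuous_psi (N : ℕ) [NeZero N] (M : SL(2, ℤ)) : Continuous (psi N M) :=
  continuous_iSup_rng (i := M) continuous_coinduced_rng

/-- The isomorphism behind `h` deforms: some map `F`, continuous at `p'`, has `F p' = p` and `ψ_{M'}
= ψ_M ∘ F` near `p'`. At a cusp `F` is a rotation with a sign; elsewhere it is the action of a fixed
`g` along a local branch of the logarithm. -/
theorem preimage_image_psi_mem_nhds {N : ℕ} [NeZero N] {M M' : SL(2, ℤ)} {p p' : Disk × ℂ}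
    (h : psi N M' p' = psi N M p) {U : Set (Disk × ℂ)} (hU : U ∈ 𝓝 p) :
    psi N M' ⁻¹' (psi N M '' U) ∈ 𝓝 p' := by
  have hN : (N : ℂ) ≠ 0 := Nat.cast_ne_zero.2 (NeZero.ne N)
  by_cases hq' : (p'.1 : ℂ) = 0
  · have hq := (eq_zero_iff_of_psi_eq h).1 hq'
    obtain ⟨ε, i, hred, hs⟩ := (psi_eq_psi_iff_of_eq_zero M M' hq hq').1 h
    have hF : Continuous fun x : Disk × ℂ => (rot N (-i) x.1, ((ε : ℤ) : ℂ) * x.2) :=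
      ((continuous_rot N (-i)).comp continuous_fst).prodMk (continuous_const.mul continuous_snd)
    have hp : (rot N (-i) p'.1, ((ε : ℤ) : ℂ) * p'.2) = p := by
      refine Prod.ext ?_ hs.symm
      rw [rot_eq_self _ hq']
      exact Subtype.ext (hq'.trans hq.symm)
    filter_upwards [hF.continuousAt (by rwa [hp] : U ∈ 𝓝 _)] with x hx
    exact ⟨_, hx, (psi_eq_psi_rot hred x).symm⟩
  · have hq : (p.1 : ℂ) ≠ 0 := fun h0 => hq' ((eq_zero_iff_of_psi_eq h).2 h0)
    have hpi := two_pi_I_ne_zero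
    have hσ := exp_two_pi_I_mul_log_div hq
    have hσ' := exp_two_pi_I_mul_log_div hq'
    obtain ⟨g, hred, hg, hs⟩ := (psi_eq_psi_iff M M' hσ hσ').1 h
    set σ := log p.1 / (2 * Real.pi * I)
    have hdet : (g 0 0 * g 1 1 - g 0 1 * g 1 0 : ℂ) = 1 := by
      have := g.det_coe
      rw [Matrix.det_fin_two] at this
      exact_mod_cast this
    -- a branch of `τ' = N log q' / (2 π i)` near `p'`, and the corresponding `τ = g⁻¹ τ'`
    let τ' : Disk × ℂ → ℂ := fun x => N * ((log (x.1 / p'.1) + log p'.1) / (2 * Real.pi * I))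
    let d : Disk × ℂ → ℂ := fun x => g 0 0 - g 1 0 * τ' x
    let τ : Disk × ℂ → ℂ := fun x => (g 1 1 * τ' x - g 0 1) / d x
    let F : Disk × ℂ → ℂ × ℂ := fun x =>
      (exp (2 * Real.pi * I * (τ x / N)), (g 1 0 * τ x + g 1 1) * x.2)
    have hτ'p : τ' p' = N * (log p'.1 / (2 * Real.pi * I)) := by simp [τ', div_self hq']
    -- `d p'` is the inverse of the automorphy factor `g 1 0 * (N * σ) + g 1 1`, by the determinant
    -- relation.
    have hdp : d p' ≠ 0 := by
      intro h0
      have h0' : g 0 0 - g 1 0 * (N * (log p'.1 / (2 * Real.pi * I))) = (0 : ℂ) := by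
        rw [← hτ'p]; exact h0
      refine one_ne_zero (α := ℂ) ?_
      linear_combination -hdet + g 1 0 * hg + (g 1 0 * (N * σ) + g 1 1) * h0'
    have hτp : τ p' = N * σ := by
      rw [div_eq_iff hdp]
      simp only [d, hτ'p]
      linear_combination hg
    have hcτ' : ContinuousAt τ' p' := by
      have h1 : ContinuousAt (fun x : Disk × ℂ => (x.1 : ℂ) / p'.1) p' :=
        (continuous_subtype_val.comp continuous_fst).continuousAt.div_const _
      -- Dividing by `p'.1` moves the argument of the logarithm close to `1`, away from the cut,
      -- wherever `p'.1` lies.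
      have h2 : (p'.1 : ℂ) / p'.1 ∈ slitPlane := by simp [div_self hq']
      exact continuousAt_const.mul (((h1.clog h2).add continuousAt_const).div_const _)
    have hcd : ContinuousAt d p' := continuousAt_const.sub (continuousAt_const.mul hcτ')
    have hcτ : ContinuousAt τ p' :=
      ((continuousAt_const.mul hcτ').sub continuousAt_const).div hcd hdp
    have hcF : ContinuousAt F p' :=
      (continuousAt_const.mul (hcτ.div_const _)).cexp.prodMk
        (((continuousAt_const.mul hcτ).add continuousAt_const).mul continuousAt_snd)
    have hFp : F p' = Prod.map Subtype.val id p := by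
      refine Prod.ext ?_ ?_
      · simp only [F, hτp, mul_div_cancel_left₀ _ hN, hσ, Prod.map_fst]
      · simp only [F, hτp, hs, Prod.map_snd, id]
    -- `F` takes values in `ℂ × ℂ`. Since the disk is open, `U` is a neighbourhood there too, so
    -- nearby values of `F` have first coordinate in the disk.
    have hemb : IsOpenEmbedding (Prod.map Subtype.val id : Disk × ℂ → ℂ × ℂ) :=
      Metric.isOpen_ball.isOpenEmbedding_subtypeVal.prodMap .id
    have hV : Prod.map Subtype.val id '' U ∈ 𝓝 (F p') := by
      rw [hFp]; exact hemb.isOpenMap.image_mem_nhds hU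
    have hne : ∀ᶠ x : Disk × ℂ in 𝓝 p', (x.1 : ℂ) ≠ 0 :=
      (continuous_subtype_val.comp continuous_fst).continuousAt.eventually_ne hq'
    filter_upwards [hcF hV, hcd.eventually_ne hdp, hne] with x hx hdx hx0
    obtain ⟨y, hy, hyx⟩ := hx
    refine ⟨y, hy, ?_⟩
    have hy1 : (y.1 : ℂ) = exp (2 * Real.pi * I * (τ x / N)) := congrArg Prod.fst hyx
    have hy2 : y.2 = (g 1 0 * τ x + g 1 1) * x.2 := congrArg Prod.snd hyx
    refine ((psi_eq_psi_iff M M' (σ' := (log (x.1 / p'.1) + log p'.1) / (2 * Real.pi * I))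
      hy1.symm ?_).2 ⟨g, hred, ?_, ?_⟩).symm
    · rw [mul_div_cancel₀ _ hpi, exp_add, exp_log (div_ne_zero hx0 hq'), exp_log hq',
        div_mul_cancel₀ _ hq']
    · rw [mul_div_cancel₀ _ hN]
      change (g 1 0 * τ x + g 1 1) * τ' x = _
      have : τ x * d x = g 1 1 * τ' x - g 0 1 := div_mul_cancel₀ _ hdx
      simp only [d] at this
      linear_combination -this
    · rw [mul_div_cancel₀ _ hN, hy2]

theorem isOpenMap_psi (N : ℕ) [NeZero N] (M : SL(2, ℤ)) : IsOpenMap (psi N M) := by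
  intro U hU
  refine isOpen_iSup_iff.2 fun M' => isOpen_coinduced.2 (isOpen_iff_mem_nhds.2 ?_)
  rintro p' ⟨p, hp, h⟩
  exact preimage_image_psi_mem_nhds h.symm (hU.mem_nhds hp)

/-! ### Injectivity near a cusp -/

/-- Since `|q| = exp (-2π Im σ)`, the radius `exp (-2π / N)` corresponds to `Im (N σ) = 1`. -/
theorem one_lt_im_of_norm_lt {N : ℕ} [NeZero N] {q σ : ℂ}
    (hσ : exp (2 * Real.pi * I * σ) = q) (hq : ‖q‖ < Real.exp (-(2 * Real.pi / N))) :
    1 < ((N : ℂ) * σ).im := by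
  have hN : (0 : ℝ) < N := Nat.cast_pos.2 (NeZero.pos N)
  rw [← hσ, norm_exp, Real.exp_lt_exp] at hq
  have hre : (2 * Real.pi * I * σ).re = -(2 * Real.pi * σ.im) := by simp
  rw [hre, neg_lt_neg_iff, div_lt_iff₀ hN] at hq
  have him : ((N : ℂ) * σ).im = N * σ.im := by simp
  rw [him]
  nlinarith [Real.pi_pos]

/-- With `c = g 1 0 ≠ 0` one would have `Im τ' = Im τ / |c τ + d|² ≤ 1 / (c² Im τ) < 1`. -/
theorem lower_left_eq_zero_of_one_lt_im {g : SL(2, ℤ)} {τ τ' : ℂ} (hτ : 1 < τ.im)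
    (hτ' : 1 < τ'.im) (h : (g 1 0 * τ + g 1 1) * τ' = g 0 0 * τ + g 0 1) : g 1 0 = 0 := by
  have hdet : (g 0 0 * g 1 1 - g 0 1 * g 1 0 : ℝ) = 1 := by
    have := g.det_coe
    rw [Matrix.det_fin_two] at this
    exact_mod_cast this
  have him := im_mul_conj_of_int (g 0 0) (g 0 1) (g 1 0) (g 1 1) τ
  rw [← h, hdet, one_mul, mul_right_comm, mul_conj, im_ofReal_mul, normSq_apply] at him
  simp only [add_im, mul_im, intCast_re, intCast_im, zero_mul, add_zero] at him
  set x := (g 1 0 * τ + g 1 1 : ℂ).re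
  by_contra hne
  have hsq : (1 : ℝ) ≤ (g 1 0 : ℝ) * g 1 0 := by
    have : 1 ≤ g 1 0 * g 1 0 := Int.add_one_le_iff.2 (mul_self_pos.2 hne)
    exact_mod_cast this
  have h1 : τ.im * τ.im ≤ x * x + (g 1 0 * τ.im) * (g 1 0 * τ.im) := by
    nlinarith [mul_self_nonneg x, mul_self_nonneg τ.im]
  have h2 : τ.im < τ.im * τ.im := by nlinarith
  nlinarith

theorem eq_of_psi_eq {N : ℕ} [NeZero N] (hN : 2 < N) {M : SL(2, ℤ)} {p p' : Disk × ℂ}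
    (hp : ‖(p.1 : ℂ)‖ < Real.exp (-(2 * Real.pi / N)))
    (hp' : ‖(p'.1 : ℂ)‖ < Real.exp (-(2 * Real.pi / N)))
    (h : psi N M p' = psi N M p) : p' = p := by
  have hN0 : (N : ℂ) ≠ 0 := Nat.cast_ne_zero.2 (NeZero.ne N)
  by_cases hq' : (p'.1 : ℂ) = 0
  · have hq := (eq_zero_iff_of_psi_eq h).1 hq'
    obtain ⟨ε, i, hred, hs⟩ := (psi_eq_psi_iff_of_eq_zero M M hq hq').1 h
    rw [map_mul, mul_eq_left] at hred
    obtain ⟨rfl, -⟩ := eq_one_and_dvd_of_red_parabolic hN hred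
    exact Prod.ext (Subtype.ext (hq'.trans hq.symm)) (by simpa using hs.symm)
  · have hq : (p.1 : ℂ) ≠ 0 := fun h0 => hq' ((eq_zero_iff_of_psi_eq h).2 h0)
    have hσ := exp_two_pi_I_mul_log_div hq
    have hσ' := exp_two_pi_I_mul_log_div hq'
    obtain ⟨g, hred, hg, hs⟩ := (psi_eq_psi_iff M M hσ hσ').1 h
    rw [map_mul, mul_eq_left] at hred
    obtain ⟨ε, i, rfl⟩ := exists_eq_parabolic (lower_left_eq_zero_of_one_lt_im
      (one_lt_im_of_norm_lt hσ hp) (one_lt_im_of_norm_lt hσ' hp') hg)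
    -- Now `N σ' = N σ + N j`, so `σ` and `σ'` differ by the integer `j` and the automorphy factor
    -- is `1`.
    obtain ⟨rfl, j, rfl⟩ := eq_one_and_dvd_of_red_parabolic hN hred
    refine Prod.ext (Subtype.ext ?_) (by simpa using hs.symm)
    rw [← hσ, ← hσ', exp_eq_exp_iff_exists_int]
    refine ⟨j, mul_left_cancel₀ hN0 ?_⟩
    simp only [parabolic_zero_zero, parabolic_zero_one, parabolic_one_zero, parabolic_one_one] at hg
    push_cast at hg
    linear_combination (2 * Real.pi * I) * hg

theorem isOpenEmbedding_psi {N : ℕ} [NeZero N] (hN : 2 < N) (M : SL(2, ℤ)) :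
    IsOpenEmbedding (fun x : {x : Disk × ℂ // ‖(x.1 : ℂ)‖ < Real.exp (-(2 * Real.pi / N))} =>
      psi N M x.1) := by
  refine .of_continuous_injective_isOpenMap ((continuous_psi N M).comp continuous_subtype_val)
    (fun x y h => Subtype.ext (eq_of_psi_eq hN y.2 x.2 h)) ?_
  refine (isOpenMap_psi N M).comp (IsOpen.isOpenMap_subtype_val ?_)
  exact isOpen_lt (continuous_subtype_val.comp continuous_fst).norm continuous_const

theorem snd_eq_of_psi_eq {N : ℕ} [NeZero N] (hN : 2 < N) {M : SL(2, ℤ)} {p p' : Disk × ℂ}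
    (hp : (p.1 : ℂ) = 0) (h : psi N M p' = psi N M p) : p'.2 = p.2 := by
  have hp' := (eq_zero_iff_of_psi_eq h).2 hp
  exact congrArg Prod.snd (eq_of_psi_eq hN (by simp [hp, Real.exp_pos])
    (by simp [hp', Real.exp_pos]) h)

/-! ### The fibre over a cusp -/

theorem proj_psi {N : ℕ} [NeZero N] (M : SL(2, ℤ)) (p : Disk × ℂ) :
    proj N (psi N M p) = psi N M (p.1, 0) := by
  by_cases hq : (p.1 : ℂ) = 0
  · rw [psi_of_eq M hq, psi_of_eq M (p := (p.1, 0)) hq]; rfl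
  · rw [psi_of_ne M hq, psi_of_ne M (p := (p.1, 0)) hq]; rfl

theorem psi_mem_fiber_iff {N : ℕ} [NeZero N] {M : SL(2, ℤ)} {q₀ : Disk} (hq₀ : (q₀ : ℂ) = 0)
    {p : Disk × ℂ} : psi N M p ∈ fiber (psi N M (q₀, 0)) ↔ (p.1 : ℂ) = 0 := by
  rw [fiber, Set.mem_ofPred_eq, proj_psi]
  refine ⟨fun h => (eq_zero_iff_of_psi_eq h).2 hq₀, fun h => ?_⟩
  rw [Subtype.ext (h.trans hq₀.symm)]

theorem exists_psi_eq_of_mem_fiber {N : ℕ} [NeZero N] {M : SL(2, ℤ)} {q₀ : Disk}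
    (hq₀ : (q₀ : ℂ) = 0) {p : T N} (hp : p ∈ fiber (psi N M (q₀, 0))) :
    ∃ s, psi N M (q₀, s) = p := by
  rw [psi_of_eq M (p := (q₀, 0)) hq₀] at hp
  induction p using Quotient.inductionOn with
  | h P =>
    have h : (P.zero).Iso (.cusp (tateTripleZero N M 0)) := mk_eq_mk.1 hp
    rcases P with P | P
    · exact h.elim
    · obtain ⟨ξ, ε, h1, h2, h3, -⟩ := h
      -- The isomorphism of the underlying curves with level structure is kept; it carries the
      -- functional `P.t` to `ε * P.t`.
      refine ⟨((ε : ℤ) : ℂ) * P.t, ?_⟩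
      rw [psi_of_eq M (p := (q₀, _)) hq₀]
      exact (mk_eq_mk (Q := .cusp P)).2 (CuspTriple.Iso.symm ⟨ξ, ε, h1, h2, h3, rfl⟩)

theorem image_psi_eq_fiber {N : ℕ} [NeZero N] {M : SL(2, ℤ)} {q₀ : Disk} (hq₀ : (q₀ : ℂ) = 0) :
    psi N M '' {x | (x.1 : ℂ) = 0} = fiber (psi N M (q₀, 0)) := by
  ext p
  constructor
  · rintro ⟨x, hx, rfl⟩
    exact (psi_mem_fiber_iff hq₀).2 hx
  · intro hp
    obtain ⟨s, rfl⟩ := exists_psi_eq_of_mem_fiber hq₀ hp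
    exact ⟨_, hq₀, rfl⟩

/-- Another `M` with the same `M ∞` differs by a right factor `± (1 i; 0 1)`, which fixes the origin
of the coordinates. -/
theorem IsCuspAt.eq_psi {N : ℕ} [NeZero N] {α : T N} {r : OnePoint ℚ} (hr : IsCuspAt α r)
    {M : SL(2, ℤ)}
    (hM : Matrix.SpecialLinearGroup.mapGL ℚ M • (OnePoint.infty : OnePoint ℚ) = r) :
    ∃ q : Disk, (q : ℂ) = 0 ∧ α = psi N M (q, 0) := by
  obtain ⟨M', hM', q, hq, rfl⟩ := hr
  obtain ⟨ε, i, h⟩ := exists_eq_mul_parabolic (hM.trans hM'.symm)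
  exact ⟨q, hq, (psi_eq_psi_iff_of_eq_zero M M' hq hq).2 ⟨ε, i, by rw [h], by simp⟩⟩

end LevelStructures

end

theorem mainTheorem5 (N : ℕ) [NeZero N] (hN : 2 < N)
    (α : LevelStructures.T N) (hα : α ∈ LevelStructures.zeroSection N)
    (r : OnePoint ℚ) (hr : LevelStructures.IsCuspAt α r)
    (M : SL(2, ℤ))
    (hM : Matrix.SpecialLinearGroup.mapGL ℚ M • (OnePoint.infty : OnePoint ℚ) = r)
    (A : SL(2, ℤ)) (hA : ∃ p ∈ LevelStructures.fiber α, A • p = p) :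
    -- `ψ_M` gives local coordinates near `α`, in which `α` is the origin and the fibre is `q = 0`
    (∃ ρ : ℝ, 0 < ρ ∧
      IsOpenEmbedding (fun x : {x : LevelStructures.Disk × ℂ // ‖(x.1 : ℂ)‖ < ρ} =>
        LevelStructures.psi N M x.1)) ∧
    LevelStructures.psi N M ⁻¹' LevelStructures.fiber α = {x | (x.1 : ℂ) = 0} ∧
    LevelStructures.psi N M '' {x | (x.1 : ℂ) = 0} = LevelStructures.fiber α ∧
    LevelStructures.psi N M ⁻¹' {α} = {x | (x.1 : ℂ) = 0 ∧ x.2 = 0} ∧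
    -- the action of `A` in these coordinates
    (∃ k : ℤ,
      (∀ (q : LevelStructures.Disk) (s : ℂ),
        A • LevelStructures.psi N M (q, s) =
          LevelStructures.psi N M (LevelStructures.rot N k q, s)) ∨
      (∀ (q : LevelStructures.Disk) (s : ℂ),
        A • LevelStructures.psi N M (q, s) =
          LevelStructures.psi N M (LevelStructures.rot N k q, -s))) ∧
    -- the fixed points of `A` on the fibre
    ((∀ p ∈ LevelStructures.fiber α, A • p = p) ∨
      {p ∈ LevelStructures.fiber α | A • p = p} = {α}) := by
  open LevelStructures in
  obtain ⟨q₀, hq₀, rfl⟩ := hr.eq_psi hM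
  refine ⟨⟨_, Real.exp_pos _, isOpenEmbedding_psi hN M⟩, Set.ext fun x => psi_mem_fiber_iff hq₀,
    image_psi_eq_fiber hq₀, Set.ext fun x => ⟨fun h => ?_, fun h => ?_⟩, ?_⟩
  · exact ⟨(eq_zero_iff_of_psi_eq h).2 hq₀, snd_eq_of_psi_eq hN hq₀ h⟩
  · exact congrArg (psi N M) (Prod.ext (Subtype.ext (h.1.trans hq₀.symm)) h.2)
  obtain ⟨p, hp, hAp⟩ := hA
  obtain ⟨s, rfl⟩ := exists_psi_eq_of_mem_fiber hq₀ hp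
  rw [smul_psi] at hAp
  -- Only the congruence is kept from the fixed point; it no longer mentions `s` and so controls all
  -- of `ψ_M`.
  obtain ⟨ε, i, hred, -⟩ := (psi_eq_psi_iff_of_eq_zero M (A * M) hq₀ hq₀).1 hAp
  have hact : ∀ q s, A • psi N M (q, s) = psi N M (rot N (-i) q, ((ε : ℤ) : ℂ) * s) := by
    intro q s
    rw [smul_psi]
    exact psi_eq_psi_rot hred (q, s)
  rcases Int.units_eq_one_or ε with rfl | rfl
  · have hact' : ∀ q s, A • psi N M (q, s) = psi N M (rot N (-i) q, s) := by simpa using hact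
    refine ⟨⟨-i, .inl hact'⟩, .inl fun p hp => ?_⟩
    obtain ⟨s, rfl⟩ := exists_psi_eq_of_mem_fiber hq₀ hp
    rw [hact', rot_eq_self _ hq₀]
  · have hact' : ∀ q s, A • psi N M (q, s) = psi N M (rot N (-i) q, -s) := by simpa using hact
    refine ⟨⟨-i, .inr hact'⟩, .inr (Set.ext fun p => ⟨?_, ?_⟩)⟩
    · rintro ⟨hp, hAp⟩
      obtain ⟨s, rfl⟩ := exists_psi_eq_of_mem_fiber hq₀ hp
      rw [hact', rot_eq_self _ hq₀] at hAp
      -- Injectivity of `ψ_M` on `q = 0` turns a fixed point into `-s = s`, leaving only the origin.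
      have hs : -s = s := snd_eq_of_psi_eq (p := (q₀, s)) hN hq₀ hAp
      rw [neg_eq_self.1 hs]
      rfl
    · rintro rfl
      refine ⟨(psi_mem_fiber_iff hq₀).2 hq₀, ?_⟩
      rw [hact', rot_eq_self _ hq₀, neg_zero]
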